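/- Let $\Omega\subset\mathbb R^n$ be a bounded domain (nonempty, open, connected). Equip $\mathcal H=H_0^1(\Omega)\times L^2(\Omega)$ with the norm $\|(u,v)\|_{\mathcal H}^2=\|\nabla u\|_{L^2(\Omega)}^2+\|v\|_{L^2(\Omega)}^2$. There is a constant $C>0$, depending only on $\Omega$, such that the following holds. Let $\rho\in C^1([0,\infty))$ satisfy $\rho(0)=0$, $\rho(s)>0$ for $s>0$, and $c_0s^\gamma\le\rho(s)\le c_1s^\gamma$ for $s\in[0,1]$, with some $c_0,c_1>0$ and $\gamma\ge1$. Let $F=(f,g)\in\mathcal H$, let $0<\lambda\le1$, and let $U_\lambda=(u_\lambda,v_\lambda)\in H_0^1(\Omega)\times H_0^1(\Omega)$ be a solution of the resolvent system $$\lambda u_\lambda-v_\lambda=f,\qquad \lambda v_\lambda-\Delta u_\lambda-\operatorname{div}\big(\rho(\|\nabla v_\lambda\|_{L^2(\Omega)}^2)\,\nabla v_\lambda\big)=g,$$ where the second equation is understood in the sense of distributions on $\Omega$. Then $$\|\nabla v_\lambda\|_{L^2(\Omega)}\le C\,\|F\|_{\mathcal H}\qquad\text{and}\qquad \|U_\lambda\|_{\mathcal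 H}\le\frac{C}{\lambda}\,\|F\|_{\mathcal H}.$$ In particular, $\|\nabla v_\lambda\|_{L^2(\Omega)}$ remains bounded as $\lambda\to0^+$. -/

import Mathlib

open MeasureTheory TopologicalSpace Set
open scoped Distributions Gradient ENNReal ContDiff RealInnerProductSpace

noncomputable section

namespace KelvinVoigt

/-- The space `ℝⁿ` with its Euclidean norm. -/
abbrev E (n : ℕ) : Type := EuclideanSpace ℝ (Fin n)

variable {n : ℕ}

/-- The scalar Lebesgue space `L²(Ω)`. -/
abbrev L2 (Ω : Opens (E n)) : Type :=
  Lp ℝ 2 ((volume : Measure (E n)).restrict (Ω : Set (E n)))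

/-- The space `L²(Ω; ℝⁿ)` of square integrable vector fields. -/
abbrev L2Vec (Ω : Opens (E n)) : Type :=
  Lp (E n) 2 ((volume : Measure (E n)).restrict (Ω : Set (E n)))

theorem memLp_test {Ω : Opens (E n)} (φ : 𝓓(Ω, ℝ)) :
    MemLp (φ : E n → ℝ) 2 ((volume : Measure (E n)).restrict (Ω : Set (E n))) :=
  (φ.continuous.memLp_of_hasCompactSupport φ.hasCompactSupport).restrict _

theorem continuous_gradient_test {Ω : Opens (E n)} (φ : 𝓓(Ω, ℝ)) :
    Continuous (∇ (φ : E n → ℝ)) :=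
  (InnerProductSpace.toDual ℝ (E n)).symm.continuous.comp (φ.contDiff.continuous_fderiv (by simp))

theorem hasCompactSupport_gradient_test {Ω : Opens (E n)} (φ : 𝓓(Ω, ℝ)) :
    HasCompactSupport (∇ (φ : E n → ℝ)) :=
  (φ.hasCompactSupport.fderiv (𝕜 := ℝ)).comp_left
    (g := (InnerProductSpace.toDual ℝ (E n)).symm) (map_zero _)

theorem memLp_gradient_test {Ω : Opens (E n)} (φ : 𝓓(Ω, ℝ)) :
    MemLp (∇ (φ : E n → ℝ)) 2 ((volume : Measure (E n)).restrict (Ω : Set (E n))) :=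
  ((continuous_gradient_test φ).memLp_of_hasCompactSupport
    (hasCompactSupport_gradient_test φ)).restrict _

/-- The linear map `φ ↦ (φ, ∇φ)` from `C_c^∞(Ω)` to `L²(Ω) × L²(Ω; ℝⁿ)`. -/
def testGraph (Ω : Opens (E n)) : 𝓓(Ω, ℝ) →ₗ[ℝ] L2 Ω × L2Vec Ω where
  toFun φ := ((memLp_test φ).toLp _, (memLp_gradient_test φ).toLp _)
  map_add' φ ψ := by
    have h : ∇ ((φ + ψ : 𝓓(Ω, ℝ)) : E n → ℝ) = ∇ (φ : E n → ℝ) + ∇ (ψ : E n → ℝ) := by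
      funext x
      have hφ : DifferentiableAt ℝ (φ : E n → ℝ) x := φ.contDiff.differentiable (by simp) x
      have hψ : DifferentiableAt ℝ (ψ : E n → ℝ) x := ψ.contDiff.differentiable (by simp) x
      simp [gradient, FunLike.coe_add, fderiv_add hφ hψ]
    refine Prod.ext ?_ ?_
    · exact (MemLp.toLp_congr (memLp_test (φ + ψ)) ((memLp_test φ).add (memLp_test ψ))
        (by simp [FunLike.coe_add])).trans (MemLp.toLp_add (memLp_test φ) (memLp_test ψ))
    · exact (MemLp.toLp_congr (memLp_gradient_test (φ + ψ))
        ((memLp_gradient_test φ).add (memLp_gradient_test ψ))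
        (by rw [h])).trans (MemLp.toLp_add (memLp_gradient_test φ) (memLp_gradient_test ψ))
  map_smul' c φ := by
    have h : ∇ ((c • φ : 𝓓(Ω, ℝ)) : E n → ℝ) = c • ∇ (φ : E n → ℝ) := by
      funext x
      have hφ : DifferentiableAt ℝ (φ : E n → ℝ) x := φ.contDiff.differentiable (by simp) x
      simp [gradient, FunLike.coe_smul, fderiv_const_smul hφ]
    refine Prod.ext ?_ ?_
    · exact (MemLp.toLp_congr (memLp_test (c • φ)) ((memLp_test φ).const_smul c)
        (by simp [FunLike.coe_smul])).trans (MemLp.toLp_const_smul c (memLp_test φ))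
    · exact (MemLp.toLp_congr (memLp_gradient_test (c • φ)) ((memLp_gradient_test φ).const_smul c)
        (by rw [h])).trans (MemLp.toLp_const_smul c (memLp_gradient_test φ))

/-- The Sobolev space `H¹₀(Ω)`, the completion of `C_c^∞(Ω)` in the `H¹` norm: an element is a
function in `L²(Ω)` together with its weak gradient in `L²(Ω; ℝⁿ)`, the pair being a limit in
`L²(Ω) × L²(Ω; ℝⁿ)` of pairs `(φ, ∇φ)` with `φ ∈ C_c^∞(Ω)`. -/
def H10 (Ω : Opens (E n)) : Submodule ℝ (L2 Ω × L2Vec Ω) :=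
  (LinearMap.range (testGraph Ω)).topologicalClosure

/-- The `L²` function underlying an element of `H¹₀(Ω)`. -/
def toL2 {Ω : Opens (E n)} (u : H10 Ω) : L2 Ω := u.1.1

/-- The weak gradient of an element of `H¹₀(Ω)`. -/
def grad {Ω : Opens (E n)} (u : H10 Ω) : L2Vec Ω := u.1.2

/-- The norm of the phase space `𝓗 = H¹₀(Ω) × L²(Ω)`:
`‖(u, v)‖² = ‖∇u‖²_{L²} + ‖v‖²_{L²}`. -/
def phaseNorm {Ω : Opens (E n)} (u : H10 Ω) (v : L2 Ω) : ℝ :=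
  Real.sqrt (‖grad u‖ ^ 2 + ‖v‖ ^ 2)

/-- The hypotheses on the nonlocal coefficient `ρ`: it is `C¹` on `[0, ∞)`, vanishes at `0`, is
positive on `(0, ∞)` and behaves like a power `s ^ γ`, `γ ≥ 1`, near `0`. -/
structure IsNonlocalCoefficient (ρ : ℝ → ℝ) : Prop where
  contDiffOn : ContDiffOn ℝ 1 ρ (Ici 0)
  map_zero : ρ 0 = 0
  pos : ∀ s : ℝ, 0 < s → 0 < ρ s
  degenerate : ∃ c₀ c₁ γ : ℝ, 0 < c₀ ∧ 0 < c₁ ∧ 1 ≤ γ ∧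
    ∀ s ∈ Icc (0 : ℝ) 1, c₀ * s ^ γ ≤ ρ s ∧ ρ s ≤ c₁ * s ^ γ

/-- `(u, v) ∈ H¹₀(Ω) × H¹₀(Ω)` solves the resolvent system
`lam u - v = f`, `lam v - Δu - div (ρ(‖∇v‖²) ∇v) = g` with data `(f, g) ∈ H¹₀(Ω) × L²(Ω)`; the
second equation holds in the sense of distributions on `Ω`. -/
structure IsResolventSolution (Ω : Opens (E n)) (ρ : ℝ → ℝ) (lam : ℝ) (f : H10 Ω) (g : L2 Ω)
    (u v : H10 Ω) : Prop where
  eq_fst : lam • u - v = f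
  eq_snd : ∀ φ : 𝓓(Ω, ℝ),
    lam * (∫ x in (Ω : Set (E n)), toL2 v x * φ x)
      + (∫ x in (Ω : Set (E n)), ⟪grad u x, ∇ (φ : E n → ℝ) x⟫)
      + (∫ x in (Ω : Set (E n)), ⟪ρ (‖grad v‖ ^ 2) • grad v x, ∇ (φ : E n → ℝ) x⟫)
      = ∫ x in (Ω : Set (E n)), g x * φ x

end KelvinVoigt

end

namespace KelvinVoigt

variable {n : ℕ} {Ω : Opens (E n)}

/-! Energy method: test the second equation with `v` itself and multiply by `lam`. Since `lam ∇u =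
∇v + ∇f`, the elastic term becomes `‖∇v‖² + ⟪∇f, ∇v⟫`, so `‖∇v‖²` is controlled without help from
the degenerate damping, whose contribution is only needed to be nonnegative. Young's inequality then
gives `energy_le`. Testing with `v` is legitimate by density (`weak_form`). -/

theorem inner_toLp_test (w : L2 Ω) (φ : 𝓓(Ω, ℝ)) :
    ⟪w, (testGraph Ω φ).1⟫ = ∫ x in (Ω : Set (E n)), w x * φ x := by
  rw [MeasureTheory.L2.inner_def]
  refine integral_congr_ae ?_
  filter_upwards [(memLp_test φ).coeFn_toLp] with x hx
  change ⟪w x, ((memLp_test φ).toLp _ : L2 Ω) x⟫ = _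
  rw [hx]
  simp [mul_comm]

theorem inner_toLp_gradient_test (w : L2Vec Ω) (φ : 𝓓(Ω, ℝ)) :
    ⟪w, (testGraph Ω φ).2⟫ = ∫ x in (Ω : Set (E n)), ⟪w x, ∇ (φ : E n → ℝ) x⟫ := by
  rw [MeasureTheory.L2.inner_def]
  refine integral_congr_ae ?_
  filter_upwards [(memLp_gradient_test φ).coeFn_toLp] with x hx
  change ⟪w x, ((memLp_gradient_test φ).toLp _ : L2Vec Ω) x⟫ = _
  rw [hx]

/-- An identity between the `L²` pairings of fixed fields with `φ` and `∇φ` extends from test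
functions to all of `H¹₀(Ω)`. -/
theorem inner_eq_of_forall_test {a : L2 Ω} {b : L2Vec Ω}
    (h : ∀ φ : 𝓓(Ω, ℝ), ⟪a, (testGraph Ω φ).1⟫ + ⟪b, (testGraph Ω φ).2⟫ = 0) (w : H10 Ω) :
    ⟪a, toL2 w⟫ + ⟪b, grad w⟫ = 0 := by
  have hclosed : IsClosed {p : L2 Ω × L2Vec Ω | ⟪a, p.1⟫ + ⟪b, p.2⟫ = 0} :=
    isClosed_eq ((continuous_const.inner continuous_fst).add
      (continuous_const.inner continuous_snd)) continuous_const
  -- `H10 Ω` is by definition the closure of the pairs `(φ, ∇φ)`.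
  refine closure_minimal ?_ hclosed w.2
  rintro _ ⟨φ, rfl⟩
  exact h φ

/-- The weak form of the second resolvent equation, tested with an element of `H¹₀(Ω)`. -/
theorem IsResolventSolution.weak_form {ρ : ℝ → ℝ} {lam : ℝ} {f : H10 Ω} {g : L2 Ω} {u v : H10 Ω}
    (h : IsResolventSolution Ω ρ lam f g u v) (w : H10 Ω) :
    lam * ⟪toL2 v, toL2 w⟫ + ⟪grad u, grad w⟫ + ρ (‖grad v‖ ^ 2) * ⟪grad v, grad w⟫
      = ⟪g, toL2 w⟫ := by
  have key := inner_eq_of_forall_test (a := lam • toL2 v - g)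
    (b := grad u + ρ (‖grad v‖ ^ 2) • grad v) (fun φ => ?_) w
  · simp only [inner_sub_left, inner_add_left, real_inner_smul_left] at key
    linarith
  · have hφ := h.eq_snd φ
    -- The nonlocal coefficient does not depend on `x`, so it leaves the integral.
    simp only [real_inner_smul_left, integral_const_mul] at hφ
    simp only [inner_sub_left, inner_add_left, real_inner_smul_left, inner_toLp_test,
      inner_toLp_gradient_test]
    linarith

theorem IsResolventSolution.smul_grad_eq {ρ : ℝ → ℝ} {lam : ℝ} {f : H10 Ω} {g : L2 Ω}
    {u v : H10 Ω} (h : IsResolventSolution Ω ρ lam f g u v) :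
    lam • grad u = grad v + grad f := by
  rw [← h.eq_fst]
  simp [grad]

theorem IsNonlocalCoefficient.nonneg {ρ : ℝ → ℝ} (hρ : IsNonlocalCoefficient ρ) {s : ℝ}
    (hs : 0 ≤ s) : 0 ≤ ρ s := by
  rcases hs.eq_or_lt with rfl | hs
  · exact hρ.map_zero.ge
  · exact (hρ.pos s hs).le

/-- The energy estimate for the resolvent system. -/
theorem IsResolventSolution.energy_le {ρ : ℝ → ℝ} (hρ : IsNonlocalCoefficient ρ) {lam : ℝ}
    (hlam : 0 < lam) {f : H10 Ω} {g : L2 Ω} {u v : H10 Ω}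
    (h : IsResolventSolution Ω ρ lam f g u v) :
    ‖grad v‖ ^ 2 + (lam * ‖toL2 v‖) ^ 2 ≤ ‖grad f‖ ^ 2 + ‖g‖ ^ 2 := by
  have hw := h.weak_form v
  have hu : lam * ⟪grad u, grad v⟫ = ‖grad v‖ ^ 2 + ⟪grad f, grad v⟫ := by
    rw [← real_inner_smul_left, h.smul_grad_eq, inner_add_left, real_inner_self_eq_norm_sq]
  rw [real_inner_self_eq_norm_sq, real_inner_self_eq_norm_sq] at hw
  -- The damping term has the good sign and is dropped.
  have hr : 0 ≤ lam * (ρ (‖grad v‖ ^ 2) * ‖grad v‖ ^ 2) :=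
    mul_nonneg hlam.le (mul_nonneg (hρ.nonneg (sq_nonneg _)) (sq_nonneg _))
  have hf : -⟪grad f, grad v⟫ ≤ ‖grad f‖ * ‖grad v‖ :=
    (neg_le_abs _).trans (abs_real_inner_le_norm _ _)
  have hg : lam * ⟪g, toL2 v⟫ ≤ lam * (‖g‖ * ‖toL2 v‖) :=
    mul_le_mul_of_nonneg_left (real_inner_le_norm _ _) hlam.le
  have hsum : ‖grad v‖ ^ 2 + (lam * ‖toL2 v‖) ^ 2
      ≤ ‖grad f‖ * ‖grad v‖ + ‖g‖ * (lam * ‖toL2 v‖) := by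
    have := congrArg (lam * ·) hw
    simp only [mul_add] at this
    linarith
  -- Young with weight 1/2 on each product; half of the left side is absorbed.
  linarith [sq_nonneg (‖grad f‖ - ‖grad v‖), sq_nonneg (‖g‖ - lam * ‖toL2 v‖)]

end KelvinVoigt

theorem mainTheorem11 {n : ℕ} (Ω : Opens (KelvinVoigt.E n))
    (hbdd : Bornology.IsBounded (Ω : Set (KelvinVoigt.E n)))
    (hconn : IsConnected (Ω : Set (KelvinVoigt.E n))) :
    ∃ C : ℝ, 0 < C ∧
      ∀ ρ : ℝ → ℝ, KelvinVoigt.IsNonlocalCoefficient ρ →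
      ∀ (f : KelvinVoigt.H10 Ω) (g : KelvinVoigt.L2 Ω) (lam : ℝ), 0 < lam → lam ≤ 1 →
      ∀ u v : KelvinVoigt.H10 Ω, KelvinVoigt.IsResolventSolution Ω ρ lam f g u v →
        ‖KelvinVoigt.grad v‖ ≤ C * KelvinVoigt.phaseNorm f g ∧
        KelvinVoigt.phaseNorm u (KelvinVoigt.toL2 v) ≤ C / lam * KelvinVoigt.phaseNorm f g := by
  -- The bounds below give `(lam ‖U‖)² ≤ (2N)² + N² = 5N²`, and `5 ≤ 3²`.
  refine ⟨3, by norm_num, fun ρ hρ f g lam hlam _ u v h => ?_⟩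
  have henergy := h.energy_le hρ hlam
  set N := KelvinVoigt.phaseNorm f g with hN
  have hN0 : 0 ≤ N := Real.sqrt_nonneg _
  have hN2 : N ^ 2 = ‖KelvinVoigt.grad f‖ ^ 2 + ‖g‖ ^ 2 := Real.sq_sqrt (by positivity)
  rw [← hN2] at henergy
  have hv : ‖KelvinVoigt.grad v‖ ≤ N :=
    abs_le_of_sq_le_sq' (by linarith [sq_nonneg (lam * ‖KelvinVoigt.toL2 v‖)]) hN0 |>.2
  have hf : ‖KelvinVoigt.grad f‖ ≤ N :=
    abs_le_of_sq_le_sq' (by linarith [sq_nonneg ‖g‖]) hN0 |>.2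
  have hv' : (lam * ‖KelvinVoigt.toL2 v‖) ^ 2 ≤ N ^ 2 := by
    linarith [sq_nonneg ‖KelvinVoigt.grad v‖]
  have hu : lam * ‖KelvinVoigt.grad u‖ ≤ 2 * N := by
    rw [← Real.norm_of_nonneg hlam.le, ← norm_smul, h.smul_grad_eq]
    linarith [norm_add_le (KelvinVoigt.grad v) (KelvinVoigt.grad f)]
  refine ⟨by linarith, Real.sqrt_le_iff.2 ⟨by positivity, ?_⟩⟩
  have hu' : (lam * ‖KelvinVoigt.grad u‖) ^ 2 ≤ (2 * N) ^ 2 :=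
    pow_le_pow_left₀ (by positivity) hu 2
  rw [div_mul_eq_mul_div, div_pow, le_div_iff₀ (by positivity)]
  linarith [sq_nonneg N]
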